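/- Let $X$ be a nonempty Tychonoff space and let $C_p(X)$ be the space of continuous real-valued functions on $X$ with the topology of pointwise convergence. Then the following are equivalent: 1. $C_p(X)\models S_1(\mathcal S,\mathcal D)$ and $C_p(X)$ is sequentially separable; 2. $X\models S_1(\Gamma_F,\Omega)$ and $X\models V$; 3. $X\models S_1(\Gamma_{cl},\Omega_{cl})$, $X\models V$, and $X$ is strongly zero-dimensional; 4. $C_p(X)\models S_1(\Gamma_x,\Omega_x)$ and $C_p(X)$ is sequentially separable; 5. $C_p(X)\models S_1(\mathcal S,\Omega_x)$ and $C_p(X)$ is sequentially separable. Here the notions are as follows. - $S_1(\mathcal A,\mathcal B)$: for every sequence $(A_n)_n$ of elements of $\mathcal A$ there are $b_n\in A_n$ with $\{b_n:n\in\mathbb N\}\in\mathcal B$. - For a space $Y$: $\mathcal D$ is the family of dense subsets of $Y$; $\mathcal S$ is the family of sequentially dense subsets of $Y$, that is, of those $A\subseteq Y$ such that every point of $Y$ is the limit of a sequence of points of $A$. The space $Y$ is sequentially separable if it has a countable sequentially dense subset. For $x\in Y$, $\Omega_x=\{A\subseteq Y: x\in\overline A\setminus A\}$, and $\Gamma_x$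 is the family of infinite $A\subseteq Y$ with $x\notin A$ such that $A\setminus U$ is finite for each neighborhood $U$ of $x$. The properties $S_1(\Gamma_x,\Omega_x)$ and $S_1(\mathcal S,\Omega_x)$ of $Y$ are required for every $x\in Y$. - A cover of $X$ is a family $\mathcal U$ of subsets of $X$ with $\bigcup\mathcal U=X$ and $X\notin\mathcal U$. It is an $\omega$-cover if every finite subset of $X$ is contained in a member of $\mathcal U$, and a $\gamma$-cover if it is infinite and each $x\in X$ belongs to all but finitely many members of $\mathcal U$. $\Omega$ is the family of open $\omega$-covers of $X$; $\Omega_{cl}$ and $\Gamma_{cl}$ are the families of $\omega$-covers and of $\gamma$-covers of $X$ by clopen sets. - A zero-set of $X$ is the set of zeros of a continuous function $X\to\mathbb R$; a cozero-set is the complement of a zero-set. $\Gamma_F$ is the family of $\gamma$-covers $\mathcal U$ of $X$ by cozero-sets for which there are zero-sets $F(U)\subseteq U$ ($U\in\mathcal U$) such that $\{F(U):U\in\mathcal U\}$ is a $\gamma$-cover of $X$. - $X\models V$ (Velichko's property): there is a continuous bijection $f$ of $X$ onto a separable metric space $Y$ such that $f(U)$ is an $F_\sigma$-set in $Y$ for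 every cozero-set $U$ of $X$. - $X$ is strongly zero-dimensional if for any two disjoint zero-sets $Z_0,Z_1$ of $X$ there is a clopen set $C$ with $Z_0\subseteq C$ and $C\cap Z_1=\emptyset$. -/

import Mathlib

open Set Filter Topology

namespace SelectionPrinciples

universe u

/-! ### Selection principle -/

/-- The selection hypothesis `S₁(𝒜, ℬ)`: from every sequence of elements of `𝒜` one can choose one
member of each term so that the set of chosen members is an element of `ℬ`. -/
def S1 {α : Type u} (𝒜 ℬ : Set (Set α)) : Prop :=
  ∀ A : ℕ → Set α, (∀ n, A n ∈ 𝒜) → ∃ b : ℕ → α, (∀ n, b n ∈ A n) ∧ Set.range b ∈ ℬ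

/-! ### Families of subsets of a topological space `Y` -/

section Families

variable (Y : Type u) [TopologicalSpace Y]

/-- `𝒟`: the dense subsets of `Y`. -/
def denseSets : Set (Set Y) := {A | Dense A}

/-- `𝒮`: the sequentially dense subsets of `Y`, i.e. those `A` such that every point of `Y` is the
limit of a sequence of points of `A`. -/
def seqDenseSets : Set (Set Y) := {A | seqClosure A = Set.univ}

/-- `Y` is sequentially separable: it has a countable sequentially dense subset. -/
def SequentiallySeparable : Prop := ∃ D : Set Y, D.Countable ∧ D ∈ seqDenseSets Y

variable {Y}

/-- `Ω_y`: the subsets `A` of `Y` with `y ∈ closure A \ A`. -/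
def OmegaAt (y : Y) : Set (Set Y) := {A | y ∈ closure A \ A}

/-- `Γ_y`: the subsets `A` of `Y` that converge to `y`, i.e. `A` is infinite, `y ∉ A`, and `A \ U` is
finite for every neighborhood `U` of `y`. -/
def GammaAt (y : Y) : Set (Set Y) := {A | A.Infinite ∧ y ∉ A ∧ ∀ U ∈ 𝓝 y, (A \ U).Finite}

end Families

/-! ### Covers of a topological space `X` -/

section Covers

variable {X : Type u}

/-- A (nontrivial) cover of `X`: a family of subsets with union `X` of which `X` is not a member. -/
def IsCover (𝒰 : Set (Set X)) : Prop := ⋃₀ 𝒰 = Set.univ ∧ Set.univ ∉ 𝒰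

/-- A `γ`-cover: an infinite cover such that each point lies in all but finitely many members. -/
def IsGammaCover (𝒰 : Set (Set X)) : Prop :=
  IsCover 𝒰 ∧ 𝒰.Infinite ∧ ∀ x : X, {U ∈ 𝒰 | x ∉ U}.Finite

/-- An `ω`-cover: a cover such that each finite subset of `X` is contained in a member. -/
def IsOmegaCover (𝒰 : Set (Set X)) : Prop :=
  IsCover 𝒰 ∧ ∀ K : Set X, K.Finite → ∃ U ∈ 𝒰, K ⊆ U

variable [TopologicalSpace X]

/-- A zero-set: the preimage of zero under a continuous real-valued function. -/
def IsZeroSet (Z : Set X) : Prop := ∃ f : X → ℝ, Continuous f ∧ Z = f ⁻¹' {0}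

/-- A cozero-set: the complement of a zero-set. -/
def IsCozeroSet (U : Set X) : Prop := IsZeroSet Uᶜ

variable (X)

/-- `Ω`: the open `ω`-covers of `X`. -/
def Omega : Set (Set (Set X)) := {𝒰 | (∀ U ∈ 𝒰, IsOpen U) ∧ IsOmegaCover 𝒰}

/-- `Ω_cl`: the clopen `ω`-covers of `X`. -/
def OmegaCl : Set (Set (Set X)) := {𝒰 | (∀ U ∈ 𝒰, IsClopen U) ∧ IsOmegaCover 𝒰}

/-- `Γ_cl`: the clopen `γ`-covers of `X`. -/
def GammaCl : Set (Set (Set X)) := {𝒰 | (∀ U ∈ 𝒰, IsClopen U) ∧ IsGammaCover 𝒰}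

/-- `Γ_F`: the `γ_F`-shrinkable `γ`-covers of `X`, i.e. the `γ`-covers `𝒰` by cozero-sets for which
there are zero-sets `F U ⊆ U` (`U ∈ 𝒰`) such that `{F U | U ∈ 𝒰}` is a `γ`-cover. -/
def GammaF : Set (Set (Set X)) :=
  {𝒰 | (∀ U ∈ 𝒰, IsCozeroSet U) ∧ IsGammaCover 𝒰 ∧
    ∃ F : Set X → Set X, (∀ U ∈ 𝒰, IsZeroSet (F U) ∧ F U ⊆ U) ∧ IsGammaCover (F '' 𝒰)}

/-- `X` is strongly zero-dimensional: any two disjoint zero-sets are separated by a clopen set. -/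
def StronglyZeroDimensional : Prop :=
  ∀ Z₀ Z₁ : Set X, IsZeroSet Z₀ → IsZeroSet Z₁ → Disjoint Z₀ Z₁ →
    ∃ C : Set X, IsClopen C ∧ Z₀ ⊆ C ∧ Disjoint C Z₁

/-- Velichko's property `V`: there is a continuous bijection of `X` onto a separable metric space
that maps every cozero-set of `X` onto an `F_σ`-set. -/
def VelichkoV : Prop :=
  ∃ (Y : Type u) (_ : MetricSpace Y) (_ : TopologicalSpace.SeparableSpace Y) (f : X → Y),
    Continuous f ∧ Function.Bijective f ∧
    ∀ U : Set X, IsCozeroSet U → ∃ F : ℕ → Set Y, (∀ n, IsClosed (F n)) ∧ f '' U = ⋃ n, F n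

/-- `C_p(X)`: the continuous real-valued functions on `X` with the topology of pointwise
convergence, as a subspace of the product `X → ℝ`. -/
abbrev Cp : Type u := {f : X → ℝ // Continuous f}

end Covers

end SelectionPrinciples

open Set Filter Topology
namespace SelectionPrinciples
universe u

/-! ### Pointwise convergence -/

section Pointwise

variable {X : Type u} [TopologicalSpace X]

/-! The five conditions split into two independent equivalences. All the selection hypotheses reduce
to `NullSelection`, about arrays of pointwise null sequences of continuous functions. A convergent
sequence minus its limit is such an array, which yields the selections in `Cp X`; conversely an
array is coded by sets converging to 0 or by sequentially dense sets. On the cover side, the sets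
where `|g| < 1`, shrunk to `|g| ≤ 1/2`, code a null sequence, and functions separating `F U` from
the complement of `U` decode a cover. Independently, Velichko's property is equivalent to sequential
separability of `Cp X`: a countable sequentially dense set supplies the coordinates of the
condensation, and conversely continuous functions on a Hilbert cube containing the metric image are
dense enough. Strong zero-dimensionality comes from `NullSelection` alone: no continuous real
function can cover `[0, 1]`, since `[0, 1]` itself defeats the selection (`exists_notMem_range`). It
lets cozero covers be replaced by clopen ones. -/

theorem Cp.tendsto_iff {ι : Type*} {l : Filter ι} {a : ι → Cp X} {f : Cp X} :
    Tendsto a l (𝓝 f) ↔ ∀ x, Tendsto (fun i => (a i).1 x) l (𝓝 (f.1 x)) := by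
  rw [tendsto_subtype_rng, tendsto_pi_nhds]

theorem Cp.mem_closure_iff {A : Set (Cp X)} {f : Cp X} :
    f ∈ closure A ↔
      ∀ K : Finset X, ∀ ε : ℝ, 0 < ε → ∃ a ∈ A, ∀ x ∈ K, |a.1 x - f.1 x| < ε := by
  constructor
  · intro h K ε hε
    have ho : IsOpen {a : Cp X | ∀ x ∈ K, |a.1 x - f.1 x| < ε} := by
      have : {a : Cp X | ∀ x ∈ K, |a.1 x - f.1 x| < ε} =
          ⋂ x ∈ K, {a : Cp X | |a.1 x - f.1 x| < ε} := by ext; simp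
      rw [this]
      refine isOpen_biInter_finset fun x _ => isOpen_lt ?_ continuous_const
      have : Continuous fun a : Cp X => a.1 x := (continuous_apply x).comp continuous_subtype_val
      exact (this.sub continuous_const).abs
    obtain ⟨a, ha, haA⟩ := _root_.mem_closure_iff.1 h _ ho (by simpa using fun x _ => hε)
    exact ⟨a, haA, ha⟩
  · intro h
    rw [closure_subtype, _root_.mem_closure_iff_nhds]
    intro t ht
    rw [nhds_pi, Filter.mem_pi] at ht
    obtain ⟨I, hI, s, hs, hst⟩ := ht
    have : ∀ x, ∃ ε > 0, Metric.ball (f.1 x) ε ⊆ s x := fun x => Metric.mem_nhds_iff.1 (hs x)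
    choose ε hε hεs using this
    obtain ⟨δ, hδ, hδε⟩ : ∃ δ > 0, ∀ x ∈ hI.toFinset, δ ≤ ε x := by
      rcases hI.toFinset.eq_empty_or_nonempty with h0 | h0
      · exact ⟨1, one_pos, by simp [h0]⟩
      · obtain ⟨y, -, hy⟩ := hI.toFinset.exists_min_image ε h0
        exact ⟨ε y, hε y, hy⟩
    obtain ⟨a, haA, ha⟩ := h hI.toFinset δ hδ
    refine ⟨a.1, hst fun x hx => hεs x ?_, mem_image_of_mem _ haA⟩
    have hx' : x ∈ hI.toFinset := by simpa using hx
    rw [Metric.mem_ball, Real.dist_eq]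
    exact (ha x hx').trans_le (hδε x hx')

theorem Cp.mem_closure_range_iff {b : ℕ → Cp X} {f : Cp X} :
    f ∈ closure (range b) ↔
      ∀ K : Finset X, ∀ ε : ℝ, 0 < ε → ∃ n, ∀ x ∈ K, |(b n).1 x - f.1 x| < ε := by
  simp [Cp.mem_closure_iff]

theorem mem_seqDenseSets {Y : Type u} [TopologicalSpace Y] {A : Set Y} (h : A ∈ seqDenseSets Y)
    (y : Y) : ∃ a : ℕ → Y, (∀ n, a n ∈ A) ∧ Tendsto a atTop (𝓝 y) := by
  have : y ∈ seqClosure A := by rw [show seqClosure A = univ from h]; trivial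
  exact this

theorem dense_of_mem_seqDenseSets {Y : Type u} [TopologicalSpace Y] {A : Set Y}
    (h : A ∈ seqDenseSets Y) : Dense A := fun y =>
  seqClosure_subset_closure (by rw [show seqClosure A = univ from h]; trivial)

/-- A sequentially separable space has a sequence every point of which is the limit of a
subsequence. -/
theorem SequentiallySeparable.exists_seq {Y : Type u} [TopologicalSpace Y] [Nonempty Y]
    (h : SequentiallySeparable Y) :
    ∃ d : ℕ → Y, range d ∈ seqDenseSets Y ∧
      ∀ y, ∃ k : ℕ → ℕ, Tendsto k atTop atTop ∧ Tendsto (d ∘ k) atTop (𝓝 y) := by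
  obtain ⟨D, hDc, hD⟩ := h
  have hne : D.Nonempty := by
    obtain ⟨y⟩ := ‹Nonempty Y›
    obtain ⟨a, ha, -⟩ := mem_seqDenseSets hD y
    exact ⟨a 0, ha 0⟩
  obtain ⟨d, rfl⟩ := hDc.exists_eq_range hne
  have hr : range (fun n : ℕ => d n.unpair.1) = range d := by
    ext y
    constructor
    · rintro ⟨n, rfl⟩; exact ⟨_, rfl⟩
    · rintro ⟨n, rfl⟩; exact ⟨Nat.pair n 0, by simp⟩
  -- Every value recurs infinitely often, so the approximating indices `Nat.pair (i k) k ≥ k` can be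
  -- made to tend to infinity.
  refine ⟨fun n => d n.unpair.1, hr ▸ hD, fun y => ?_⟩
  obtain ⟨a, ha, hay⟩ := mem_seqDenseSets hD y
  choose i hi using ha
  refine ⟨fun k => Nat.pair (i k) k, ?_, ?_⟩
  · exact tendsto_atTop_mono (fun k => Nat.right_le_pair _ _) tendsto_id
  · have : (fun n : ℕ => d n.unpair.1) ∘ (fun k => Nat.pair (i k) k) = a := by
      ext1 k; simp [hi]
    rwa [this]

end Pointwise

/-! ### Selecting small values from pointwise null sequences -/

section NullSelection

variable (X : Type u) [TopologicalSpace X]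

/-- From every sequence of pointwise null sequences of continuous functions one can select a
member of each so that every finite set has a selected function smaller than `1` on it. -/
def NullSelection : Prop :=
  ∀ g : ℕ → ℕ → X → ℝ, (∀ n j, Continuous (g n j)) →
    (∀ n x, Tendsto (fun j => g n j x) atTop (𝓝 0)) →
    ∃ φ : ℕ → ℕ, ∀ K : Finset X, ∃ n, ∀ x ∈ K, |g n (φ n) x| < 1

variable {X}

/-- Split the indices into infinitely many blocks and scale block `k` by `k + 1`: the bound `1`
becomes `1 / (k + 1)`, and block `max k N` has only indices `≥ N`. -/
theorem NullSelection.exists_frequently (h : NullSelection X) (g : ℕ → ℕ → X → ℝ)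
    (hg : ∀ n j, Continuous (g n j)) (hg0 : ∀ n x, Tendsto (fun j => g n j x) atTop (𝓝 0)) :
    ∃ φ : ℕ → ℕ, ∀ K : Finset X, ∀ ε : ℝ, 0 < ε → ∀ N, ∃ n ≥ N, ∀ x ∈ K, |g n (φ n) x| < ε := by
  have (k : ℕ) := h (fun m j x => (k + 1) * g (Nat.pair k m) j x)
    (fun m j => continuous_const.mul (hg _ _))
    (fun m x => by simpa using (hg0 (Nat.pair k m) x).const_mul ((k : ℝ) + 1))
  choose φ hφ using this
  refine ⟨fun n => φ n.unpair.1 n.unpair.2, fun K ε hε N => ?_⟩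
  obtain ⟨k, hk⟩ := exists_nat_one_div_lt hε
  obtain ⟨m, hm⟩ := hφ (max k N) K
  refine ⟨Nat.pair (max k N) m, (le_max_right _ _).trans (Nat.left_le_pair _ _), fun x hx => ?_⟩
  have h1 := hm x hx
  simp only [Nat.unpair_pair]
  set v := g (Nat.pair (max k N) m) (φ (max k N) m) x
  have hpos : (0 : ℝ) < ((max k N : ℕ) : ℝ) + 1 := by positivity
  rw [abs_mul, abs_of_pos hpos, ← lt_div_iff₀' hpos] at h1
  refine h1.trans_le (le_trans ?_ hk.le)
  gcongr
  exact le_max_left _ _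

/-- The selection of approximations to a prescribed sequence of limits, each `h i` being
approximated along the `i`-th block of a partition of the indices. -/
theorem NullSelection.exists_blocks (h : NullSelection X) (a : ℕ → ℕ → Cp X) (f : ℕ → Cp X)
    (ha : ∀ n, Tendsto (a n) atTop (𝓝 (f n.unpair.1))) :
    ∃ φ : ℕ → ℕ, ∀ i, f i ∈ closure (range fun n => a n (φ n)) := by
  have (i : ℕ) := h.exists_frequently
    (fun m j x => (a (Nat.pair i m) j).1 x - (f i).1 x) (fun m j => by
      have h1 := (a (Nat.pair i m) j).2
      have h2 := (f i).2
      fun_prop) (fun m x => by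
      have := Cp.tendsto_iff.1 (ha (Nat.pair i m)) x
      simpa using this.sub_const ((f i).1 x))
  choose φ hφ using this
  refine ⟨fun n => φ n.unpair.1 n.unpair.2, fun i => Cp.mem_closure_range_iff.2 fun K ε hε => ?_⟩
  obtain ⟨m, -, hm⟩ := hφ i K ε hε 0
  exact ⟨Nat.pair i m, by simpa using hm⟩

theorem NullSelection.s1_seqDense_dense (h : NullSelection X)
    (hs : SequentiallySeparable (Cp X)) : S1 (seqDenseSets (Cp X)) (denseSets (Cp X)) := by
  intro A hA
  have : Nonempty (Cp X) := ⟨⟨0, continuous_zero⟩⟩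
  obtain ⟨d, hd, -⟩ := hs.exists_seq
  choose a haA ha using fun n : ℕ => mem_seqDenseSets (hA n) (d n.unpair.1)
  obtain ⟨φ, hφ⟩ := h.exists_blocks a d ha
  refine ⟨fun n => a n (φ n), fun n => haA _ _, ?_⟩
  exact dense_closure.1 ((dense_of_mem_seqDenseSets hd).mono (range_subset_iff.2 hφ))

theorem NullSelection.s1_gammaAt_omegaAt (h : NullSelection X) (f : Cp X) :
    S1 (GammaAt f) (OmegaAt f) := by
  intro A hA
  have ha (n : ℕ) : Tendsto (fun j => ((hA n).1.natEmbedding _ j : Cp X)) atTop (𝓝 f) := by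
    intro U hU
    have hfin := (hA n).2.2 U hU
    have : Set.Finite {j | ((hA n).1.natEmbedding _ j : Cp X) ∉ U} := by
      refine Set.Finite.of_finite_image (f := fun j => ((hA n).1.natEmbedding _ j : Cp X))
        (hfin.subset ?_) ?_
      · rintro _ ⟨j, hj, rfl⟩
        exact ⟨Subtype.coe_prop _, hj⟩
      · exact (Subtype.val_injective.comp ((hA n).1.natEmbedding _).injective).injOn
    have h2 := this.compl_mem_cofinite
    rw [Nat.cofinite_eq_atTop] at h2
    rw [mem_map]
    filter_upwards [h2] with j hj
    simpa using hj
  obtain ⟨φ, hφ⟩ := h.exists_blocks (fun n j => ((hA n).1.natEmbedding _ j : Cp X)) (fun _ => f) ha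
  refine ⟨_, fun n => Subtype.coe_prop ((hA n).1.natEmbedding _ (φ n)), hφ 0, ?_⟩
  rintro ⟨n, hn⟩
  exact (hA n).2.1 (hn ▸ Subtype.coe_prop ((hA n).1.natEmbedding _ (φ n)))

theorem NullSelection.s1_seqDense_omegaAt [Nonempty X] (h : NullSelection X) (f : Cp X) :
    S1 (seqDenseSets (Cp X)) (OmegaAt f) := by
  intro A hA
  obtain ⟨x₀⟩ := ‹Nonempty X›
  -- Aiming at targets different from `f` but tending to it keeps `f` itself out of the selection.
  let c : ℕ → Cp X := fun n => ⟨fun x => f.1 x + 1 / ((n : ℝ) + 1), f.2.add continuous_const⟩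
  have hc (n : ℕ) : c n ≠ f := fun he => by
    have := congrFun (congrArg Subtype.val he) x₀
    have hp : (0 : ℝ) < 1 / ((n : ℝ) + 1) := by positivity
    simp only [c] at this
    linarith
  have hex (n : ℕ) : ∃ a : ℕ → Cp X, (∀ j, a j ∈ A n) ∧ (∀ j, a j ≠ f) ∧
      Tendsto a atTop (𝓝 (c n)) := by
    obtain ⟨a, haA, ha⟩ := mem_seqDenseSets (hA n) (c n)
    obtain ⟨N, hN⟩ := eventually_atTop.1 (ha.eventually_ne (hc n))
    exact ⟨fun j => a (j + N), fun j => haA _, fun j => hN _ (by omega),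
      (tendsto_add_atTop_iff_nat N).2 ha⟩
  choose a haA haf ha using hex
  obtain ⟨φ, hφ⟩ := h.exists_frequently (fun n j x => (a n j).1 x - (c n).1 x)
    (fun n j => (a n j).2.sub (c n).2)
    (fun n x => by simpa using (Cp.tendsto_iff.1 (ha n) x).sub_const ((c n).1 x))
  refine ⟨fun n => a n (φ n), fun n => haA _ _, Cp.mem_closure_range_iff.2 fun K ε hε => ?_, ?_⟩
  · obtain ⟨N, hN⟩ := exists_nat_one_div_lt (half_pos hε)
    obtain ⟨n, hn, hK⟩ := hφ K (ε / 2) (half_pos hε) N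
    refine ⟨n, fun x hx => ?_⟩
    have h1 := abs_lt.1 (hK x hx)
    have h2 : (1 : ℝ) / (n + 1) ≤ 1 / (N + 1) := by gcongr
    have hp : (0 : ℝ) < 1 / ((n : ℝ) + 1) := by positivity
    simp only [c] at h1
    rw [abs_lt]
    constructor <;> linarith [h1.1, h1.2]
  · rintro ⟨n, hn⟩
    exact haf _ _ hn

theorem NullSelection.of_s1_gammaAt [Nonempty X]
    (h : S1 (GammaAt (⟨0, continuous_zero⟩ : Cp X)) (OmegaAt (⟨0, continuous_zero⟩ : Cp X))) :
    NullSelection X := by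
  intro g hg hg0
  obtain ⟨x₀⟩ := ‹Nonempty X›
  -- The added term makes each function strictly positive, hence nonzero. The range is then
  -- infinite: a finite range would be closed and contain the limit 0.
  let a : ℕ → ℕ → Cp X := fun n j =>
    ⟨fun x => |g n j x| + 1 / ((j : ℝ) + 1), (hg n j).abs.add continuous_const⟩
  have hpos (n j x) : 0 < (a n j).1 x := by simp only [a]; positivity
  have hne (n j) : a n j ≠ ⟨0, continuous_zero⟩ := fun he => by
    have := congrFun (congrArg Subtype.val he) x₀
    exact (hpos n j x₀).ne' this
  have ha (n) : Tendsto (a n) atTop (𝓝 ⟨0, continuous_zero⟩) := by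
    rw [Cp.tendsto_iff]
    intro x
    simpa [a] using (hg0 n x).abs.add (tendsto_one_div_add_atTop_nhds_zero_nat (𝕜 := ℝ))
  obtain ⟨b, hb, hcl, -⟩ := h (fun n => range (a n)) fun n => by
    have hfin : ∀ U ∈ 𝓝 (⟨0, continuous_zero⟩ : Cp X), (range (a n) \ U).Finite := by
      intro U hU
      obtain ⟨N, hN⟩ := eventually_atTop.1 (ha n hU)
      refine ((Set.finite_lt_nat N).image (a n)).subset ?_
      rintro _ ⟨⟨j, rfl⟩, hj⟩
      exact ⟨j, lt_of_not_ge fun hNj => hj (hN j hNj), rfl⟩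
    have h0 : (⟨0, continuous_zero⟩ : Cp X) ∉ range (a n) := by
      rintro ⟨j, hj⟩
      exact hne n j hj
    refine ⟨fun hf => h0 ?_, h0, hfin⟩
    exact hf.isClosed.mem_of_tendsto (ha n) (Eventually.of_forall fun j => mem_range_self j)
  choose φ hφ using hb
  refine ⟨φ, fun K => ?_⟩
  obtain ⟨n, hn⟩ := Cp.mem_closure_range_iff.1 hcl K 1 one_pos
  refine ⟨n, fun x hx => ?_⟩
  have h1 := hn x hx
  have h2 : (0 : ℝ) < 1 / ((φ n : ℝ) + 1) := by positivity
  simp only [← hφ n, a, Pi.zero_apply, sub_zero] at h1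
  exact lt_of_lt_of_le (by linarith) (le_of_abs_le h1.le)

/-- Deform the sequence `d` by `d j * (1 - t) + t` with `t = min 1 |g n j|`. As `t` is pointwise
null, sequential density survives; where `|g n j| ≥ 1` the deformed function equals `1`, so being
within `1` of 0 forces `|g n j| < 1`. -/
theorem NullSelection.of_seqDenseSets (hs : SequentiallySeparable (Cp X))
    (h : ∀ A : ℕ → Set (Cp X), (∀ n, A n ∈ seqDenseSets (Cp X)) →
      ∃ b : ℕ → Cp X, (∀ n, b n ∈ A n) ∧ (⟨0, continuous_zero⟩ : Cp X) ∈ closure (range b)) :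
    NullSelection X := by
  intro g hg hg0
  have : Nonempty (Cp X) := ⟨⟨0, continuous_zero⟩⟩
  obtain ⟨d, -, hd⟩ := hs.exists_seq
  let t : ℕ → ℕ → X → ℝ := fun n j x => min 1 |g n j x|
  have ht (n j) : Continuous (t n j) := continuous_const.min (hg n j).abs
  have ht0 (n x) : Tendsto (fun j => t n j x) atTop (𝓝 0) := by
    simpa [t] using (tendsto_const_nhds (x := (1 : ℝ))).min (hg0 n x).abs
  let a : ℕ → ℕ → Cp X := fun n j =>
    ⟨fun x => (d j).1 x * (1 - t n j x) + t n j x,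
      ((d j).2.mul (continuous_const.sub (ht n j))).add (ht n j)⟩
  obtain ⟨b, hb, hcl⟩ := h (fun n => range (a n)) fun n => by
    refine eq_univ_of_forall fun y => ?_
    obtain ⟨k, hk, hky⟩ := hd y
    refine ⟨fun i => a n (k i), fun i => mem_range_self _, Cp.tendsto_iff.2 fun x => ?_⟩
    have h1 := Cp.tendsto_iff.1 hky x
    have h2 := (ht0 n x).comp hk
    simpa using (h1.mul (h2.const_sub 1)).add h2
  choose φ hφ using hb
  refine ⟨φ, fun K => ?_⟩
  obtain ⟨n, hn⟩ := Cp.mem_closure_range_iff.1 hcl K 1 one_pos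
  refine ⟨n, fun x hx => ?_⟩
  by_contra hge
  have h1 := hn x hx
  have h2 : t n (φ n) x = 1 := min_eq_left (not_lt.1 hge)
  simp [← hφ n, a, h2] at h1

end NullSelection

/-! ### Covers and pointwise null sequences -/

section CoverSelection

variable {X : Type u}

/-- A pointwise cofinite family of proper subsets, indexed by an infinite set, is a `γ`-cover. -/
theorem isGammaCover_image {ι : Type*} {I : Set ι} (hI : I.Infinite) (S : ι → Set X)
    (hS : ∀ i ∈ I, S i ≠ univ) (hfin : ∀ x, {i ∈ I | x ∉ S i}.Finite) :
    IsGammaCover (S '' I) := by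
  refine ⟨⟨eq_univ_of_forall fun x => ?_, ?_⟩, ?_, fun x => ?_⟩
  · obtain ⟨i, hi, hx⟩ := (hI.sdiff (hfin x)).nonempty
    exact ⟨S i, mem_image_of_mem S hi, by_contra fun h => hx ⟨hi, h⟩⟩
  · rintro ⟨i, hi, h⟩
    exact hS i hi h
  · intro hf
    -- A set attained for infinitely many indices contains every point by cofiniteness, so it would
    -- be all of `X`.
    obtain ⟨T, hT, hTinf⟩ : ∃ T ∈ S '' I, {i ∈ I | S i = T}.Infinite := by
      by_contra! hcon
      refine hI ((hf.biUnion fun T hT => hcon T hT).subset fun i hi => ?_)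
      exact mem_biUnion (mem_image_of_mem S hi) ⟨hi, rfl⟩
    obtain ⟨i, hi, rfl⟩ := hT
    refine hS i hi (eq_univ_of_forall fun x => ?_)
    obtain ⟨j, hj, hx⟩ := (hTinf.sdiff (hfin x)).nonempty
    exact hj.2 ▸ by_contra fun h => hx ⟨hj.1, h⟩
  · refine ((hfin x).image S).subset ?_
    rintro _ ⟨⟨i, hi, rfl⟩, hx⟩
    exact ⟨i, ⟨hi, hx⟩, rfl⟩

theorem isOmegaCover_range {b : ℕ → Set X} (hb : ∀ n, b n ≠ univ)
    (h : ∀ K : Finset X, ∃ n, ↑K ⊆ b n) : IsOmegaCover (range b) := by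
  refine ⟨⟨eq_univ_of_forall fun x => ?_, ?_⟩, fun K hK => ?_⟩
  · obtain ⟨n, hn⟩ := h {x}
    exact ⟨b n, mem_range_self n, hn (by simp)⟩
  · rintro ⟨n, hn⟩
    exact hb n hn
  · obtain ⟨n, hn⟩ := h hK.toFinset
    exact ⟨b n, mem_range_self n, by simpa using hn⟩

variable [TopologicalSpace X]

theorem IsZeroSet.isClosed {Z : Set X} (h : IsZeroSet Z) : IsClosed Z := by
  obtain ⟨f, hf, rfl⟩ := h
  exact isClosed_singleton.preimage hf

theorem IsCozeroSet.isOpen {U : Set X} (h : IsCozeroSet U) : IsOpen U :=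
  isClosed_compl_iff.1 (IsZeroSet.isClosed h)

theorem isZeroSet_le {f g : X → ℝ} (hf : Continuous f) (hg : Continuous g) :
    IsZeroSet {x | f x ≤ g x} := by
  refine ⟨fun x => max (f x - g x) 0, (hf.sub hg).max continuous_const, ?_⟩
  ext x
  simp

theorem isCozeroSet_lt {f g : X → ℝ} (hf : Continuous f) (hg : Continuous g) :
    IsCozeroSet {x | f x < g x} := by
  have : {x | f x < g x}ᶜ = {x | g x ≤ f x} := by ext; simp
  rw [IsCozeroSet, this]
  exact isZeroSet_le hg hf

theorem _root_.IsClopen.isZeroSet {C : Set X} (hC : IsClopen C) : IsZeroSet C := by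
  classical
  refine ⟨Cᶜ.indicator 1, (IsClopen.compl hC).continuous_indicator continuous_one, ?_⟩
  ext x
  by_cases hx : x ∈ C <;> simp [hx]

theorem _root_.IsClopen.isCozeroSet {C : Set X} (hC : IsClopen C) : IsCozeroSet C :=
  (IsClopen.compl hC).isZeroSet

/-- Disjoint zero-sets are separated by a continuous function. -/
theorem IsZeroSet.exists_separating {Z₀ Z₁ : Set X} (h₀ : IsZeroSet Z₀) (h₁ : IsZeroSet Z₁)
    (hd : Disjoint Z₀ Z₁) : ∃ f : X → ℝ, Continuous f ∧ (∀ x, 0 ≤ f x ∧ f x ≤ 1) ∧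
      (∀ x ∈ Z₀, f x = 0) ∧ ∀ x ∈ Z₁, f x = 1 := by
  obtain ⟨a, ha, rfl⟩ := h₀
  obtain ⟨b, hb, rfl⟩ := h₁
  have hpos (x) : 0 < |a x| + |b x| := by
    by_contra hle
    have h1 := abs_nonneg (a x)
    have h2 := abs_nonneg (b x)
    exact disjoint_left.1 hd (abs_eq_zero.1 (by linarith) : a x = 0)
      (abs_eq_zero.1 (by linarith) : b x = 0)
  refine ⟨fun x => |a x| / (|a x| + |b x|), ha.abs.div (ha.abs.add hb.abs) fun x => (hpos x).ne',
    fun x => ⟨by positivity, ?_⟩, fun x hx => ?_, fun x hx => ?_⟩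
  · rw [div_le_one (hpos x)]
    linarith [abs_nonneg (b x)]
  · have : a x = 0 := hx
    simp [this]
  · have h0 : b x = 0 := hx
    have h1 := hpos x
    rw [h0, abs_zero, add_zero] at h1
    simp [h0, h1.ne']

/-- A `γ_F`-shrinkable cover contains an infinite subfamily along which the shrinking is
pointwise cofinite. -/
theorem exists_subfamily_of_mem_gammaF {𝒰 : Set (Set X)} (h : 𝒰 ∈ GammaF X) :
    ∃ 𝒱 ⊆ 𝒰, 𝒱.Infinite ∧ ∃ F : Set X → Set X, (∀ U ∈ 𝒱, IsZeroSet (F U) ∧ F U ⊆ U) ∧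
      ∀ x, {U ∈ 𝒱 | x ∉ F U}.Finite := by
  obtain ⟨-, -, F, hF, -, hinf, hfin⟩ := h
  -- `F` need not be injective; keeping one `U` for each value lets cofiniteness pull back from the
  -- image.
  obtain ⟨𝒱, h𝒱, hinj, him⟩ := (surjOn_image F 𝒰).exists_subset_injOn_image_eq
  refine ⟨𝒱, h𝒱, fun hf => hinf (him ▸ hf.image F), F, fun U hU => hF U (h𝒱 hU), fun x => ?_⟩
  refine Set.Finite.of_finite_image (f := F) ((hfin x).subset ?_)
    (hinj.mono fun U hU => hU.1)
  rintro _ ⟨U, ⟨hU, hx⟩, rfl⟩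
  exact ⟨mem_image_of_mem F (h𝒱 hU), hx⟩

theorem NullSelection.s1_gammaF_omega (h : NullSelection X) : S1 (GammaF X) (Omega X) := by
  intro 𝒰 h𝒰
  choose 𝒱 h𝒱 hinf F hF hfin using fun n => exists_subfamily_of_mem_gammaF (h𝒰 n)
  let U : ℕ → ℕ → Set X := fun n j => (hinf n).natEmbedding _ j
  have hU (n j) : U n j ∈ 𝒱 n := Subtype.coe_prop _
  have hsep (n j) := (hF n _ (hU n j)).1.exists_separating ((h𝒰 n).1 _ (h𝒱 n (hU n j)))
    (disjoint_compl_right.mono_left (hF n _ (hU n j)).2)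
  choose g hg hg01 hg0 hg1 using hsep
  obtain ⟨φ, hφ⟩ := h g hg fun n x => by
    have : Set.Finite {j | x ∉ F n (U n j)} := by
      refine Set.Finite.of_finite_image (f := U n) ((hfin n x).subset ?_) ?_
      · rintro _ ⟨j, hj, rfl⟩
        exact ⟨hU n j, hj⟩
      · exact (Subtype.val_injective.comp ((hinf n).natEmbedding _).injective).injOn
    have h2 := this.compl_mem_cofinite
    rw [Nat.cofinite_eq_atTop] at h2
    refine tendsto_const_nhds.congr' ?_
    filter_upwards [h2] with j hj
    exact (hg0 n j x (by simpa using hj)).symm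
  have hmem (n) : U n (φ n) ∈ 𝒰 n := h𝒱 n (hU n _)
  refine ⟨fun n => U n (φ n), hmem, ?_, isOmegaCover_range (fun n he => ?_) fun K => ?_⟩
  · rintro _ ⟨n, rfl⟩
    exact ((h𝒰 n).1 _ (hmem n)).isOpen
  · exact (h𝒰 n).2.1.1.2 (he ▸ hmem n)
  · obtain ⟨n, hn⟩ := hφ K
    refine ⟨n, fun x hx => ?_⟩
    by_contra hxU
    have h1 := hn x hx
    simp [hg1 n (φ n) x hxU] at h1

theorem NullSelection.of_s1_gammaF (h : S1 (GammaF X) (Omega X)) : NullSelection X := by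
  intro g hg hg0
  -- If some function is below `1` everywhere, choosing it suffices; otherwise the sets `{|g n j| <
  -- 1}` are all proper, as a cover requires.
  by_cases hex : ∃ n j, ∀ x, |g n j x| < 1
  · obtain ⟨n, j, hj⟩ := hex
    exact ⟨fun _ => j, fun K => ⟨n, fun x _ => hj x⟩⟩
  have hU (n j) : {x | |g n j x| < 1} ≠ univ := fun he =>
    hex ⟨n, j, fun x => by simpa using he.ge (mem_univ x)⟩
  have hfin (n) (x) (c : ℝ) (hc : 0 < c) : {j | ¬ |g n j x| < c}.Finite := by
    have h1 := (hg0 n x).abs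
    rw [abs_zero] at h1
    obtain ⟨N, hN⟩ := eventually_atTop.1 (h1.eventually_lt_const hc)
    exact (Set.finite_lt_nat N).subset fun j hj => lt_of_not_ge fun hNj => hj (hN j hNj)
  have hγ (n) : IsGammaCover (range fun j => {x | |g n j x| < 1}) := by
    rw [← image_univ]
    exact isGammaCover_image infinite_univ _ (fun j _ => hU n j) fun x => by
      simpa using hfin n x 1 one_pos
  obtain ⟨b, hb, -, hω⟩ := h (fun n => range fun j => {x | |g n j x| < 1}) fun n => by
    refine ⟨?_, hγ n, ?_⟩
    · rintro _ ⟨j, rfl⟩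
      exact isCozeroSet_lt (hg n j).abs continuous_const
    -- The shrinking must depend on the set only, while several indices may give the same set; one
    -- index is fixed per set, with `0` as a default off the family.
    have hidx (U : Set X) : ∃ j, U ∈ range (fun j => {x | |g n j x| < 1}) →
        {x | |g n j x| < 1} = U := by
      by_cases hU : U ∈ range (fun j => {x | |g n j x| < 1})
      · obtain ⟨j, hj⟩ := hU
        exact ⟨j, fun _ => hj⟩
      · exact ⟨0, fun h => absurd h hU⟩
    choose j hj using hidx
    have hsub (U) (hU : U ∈ range fun j => {x | |g n j x| < 1}) :
        {x | |g n (j U) x| ≤ 1 / 2} ⊆ U := by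
      nth_rewrite 2 [← hj U hU]
      intro x hx
      exact lt_of_le_of_lt (show |g n (j U) x| ≤ 1 / 2 from hx) (by norm_num)
    refine ⟨fun U => {x | |g n (j U) x| ≤ 1 / 2},
      fun U hU => ⟨isZeroSet_le (hg n _).abs continuous_const, hsub U hU⟩,
      isGammaCover_image (hγ n).2.1 _ (fun U hU he => (hγ n).1.2 ?_) fun x => ?_⟩
    · exact (univ_subset_iff.1 (he ▸ hsub U hU)) ▸ hU
    · refine Set.Finite.of_finite_image (f := j) ((hfin n x (1 / 2) (by norm_num)).subset ?_) ?_
      · rintro _ ⟨U, ⟨hU, hx⟩, rfl⟩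
        exact fun h => hx (le_of_lt h)
      · intro U hU V hV he
        rw [← hj U hU.1, ← hj V hV.1, he]
  choose φ hφ using hb
  refine ⟨φ, fun K => ?_⟩
  obtain ⟨_, ⟨n, rfl⟩, hn⟩ := hω.2 K K.finite_toSet
  refine ⟨n, fun x hx => ?_⟩
  have := hn hx
  rw [← hφ n] at this
  exact this

/-! ### Strong zero-dimensionality -/

/-- The Cantor set maps onto the Hilbert cube, and each coordinate extends to the line by Tietze. -/
theorem exists_continuous_real_surjOn_hilbertCube :
    ∃ p : ℕ → ℝ → ℝ, (∀ n, Continuous (p n)) ∧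
      ∀ y : ℕ → unitInterval, ∃ t ∈ Icc (0 : ℝ) 1, ∀ n, p n t = y n := by
  have (n : ℕ) : ∃ q : C(ℝ, ℝ), q.restrict cantorSet =
      ⟨fun s => (cantorToHilbert (cantorSetHomeomorphNatToBool s) n : ℝ), by
        have := cantorToHilbert_continuous
        fun_prop⟩ :=
    ContinuousMap.exists_restrict_eq isClosed_cantorSet _
  choose q hq using this
  refine ⟨fun n => q n, fun n => (q n).continuous, fun y => ?_⟩
  obtain ⟨s, rfl⟩ := cantorToHilbert_surjective.comp cantorSetHomeomorphNatToBool.surjective y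
  exact ⟨s, cantorSet_subset_unitInterval s.2, fun n => by simpa using DFunLike.congr_fun (hq n) s⟩

/-- The bumps `β j` tend to 0 pointwise, yet `β j (1 / (j + 1)) = 1`. Whatever `φ` is selected for
`β j ∘ p n ∘ f`, some `t` has `p n t = 1 / (φ n + 1)` for all `n` at once; a point over `t` then
refutes the selection. -/
theorem NullSelection.exists_notMem_range (h : NullSelection X) {f : X → ℝ} (hf : Continuous f) :
    ∃ t ∈ Icc (0 : ℝ) 1, t ∉ range f := by
  obtain ⟨p, hp, hsurj⟩ := exists_continuous_real_surjOn_hilbertCube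
  by_contra! hcon
  let β : ℕ → ℝ → ℝ := fun j y => 2 * ((j + 1) * y) / (1 + ((j + 1) * y) ^ 2)
  have hβ (j) : Continuous (β j) := by
    refine Continuous.div (by fun_prop) (by fun_prop) fun y => by positivity
  have hβ0 (y) : Tendsto (fun j => β j y) atTop (𝓝 0) := by
    rcases eq_or_ne y 0 with rfl | hy
    · simp [β]
    have h1 : Tendsto (fun j : ℕ => 2 / |y| * (1 / ((j : ℝ) + 1))) atTop (𝓝 0) := by
      simpa using tendsto_one_div_add_atTop_nhds_zero_nat.const_mul (2 / |y|)
    refine squeeze_zero_norm (fun j => ?_) h1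
    have hy' : 0 < |y| := abs_pos.2 hy
    have hj : (0 : ℝ) < j + 1 := by positivity
    have hpos : (0 : ℝ) < 1 + ((j + 1) * y) ^ 2 := by positivity
    simp only [β]
    rw [Real.norm_eq_abs, abs_div, abs_of_pos hpos, abs_mul, abs_mul, abs_of_pos hj, abs_two,
      div_mul_div_comm, div_le_div_iff₀ hpos (by positivity), mul_pow, ← sq_abs y]
    nlinarith
  obtain ⟨φ, hφ⟩ := h (fun n j x => β j (p n (f x))) (fun n j => (hβ j).comp ((hp n).comp hf))
    fun n x => hβ0 _
  obtain ⟨t, ht, hpt⟩ := hsurj fun n => ⟨1 / ((φ n : ℝ) + 1), by positivity, by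
    rw [div_le_one (by positivity)]; simp⟩
  obtain ⟨x, rfl⟩ := hcon t ht
  obtain ⟨n, hn⟩ := hφ {x}
  have h1 := hn x (by simp)
  have hj : (φ n : ℝ) + 1 ≠ 0 := by positivity
  simp only [hpt, β, mul_one_div_cancel hj] at h1
  norm_num at h1

/-- A separating function misses some `t` in `[0, 1]`, so cutting at `t` gives a clopen set. -/
theorem NullSelection.stronglyZeroDimensional (h : NullSelection X) :
    StronglyZeroDimensional X := by
  intro Z₀ Z₁ h₀ h₁ hd
  obtain ⟨f, hf, -, hf0, hf1⟩ := h₀.exists_separating h₁ hd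
  obtain ⟨t, ht, htr⟩ := h.exists_notMem_range hf
  have hne (x) : f x ≠ t := fun he => htr ⟨x, he⟩
  have heq : {x | f x < t} = {x | f x ≤ t} := by
    ext x
    exact ⟨fun hx => le_of_lt (show f x < t from hx), fun hx => lt_of_le_of_ne hx (hne x)⟩
  refine ⟨{x | f x < t}, ⟨heq ▸ isClosed_le hf continuous_const, isOpen_lt hf continuous_const⟩,
    fun x hx => ?_, disjoint_left.2 fun x (hx : f x < t) hx1 => ?_⟩
  · have h1 := hne x
    rw [hf0 x hx] at h1
    show f x < t
    rw [hf0 x hx]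
    exact lt_of_le_of_ne ht.1 h1
  · rw [hf1 x hx1] at hx
    exact absurd ht.2 (not_le.2 hx)

theorem s1_gammaCl_of_s1_gammaF (h : S1 (GammaF X) (Omega X)) : S1 (GammaCl X) (OmegaCl X) := by
  intro 𝒰 h𝒰
  obtain ⟨b, hb, -, hω⟩ := h 𝒰 fun n => ⟨fun U hU => ((h𝒰 n).1 U hU).isCozeroSet, (h𝒰 n).2, id,
    fun U hU => ⟨((h𝒰 n).1 U hU).isZeroSet, subset_rfl⟩, by simpa using (h𝒰 n).2⟩
  refine ⟨b, hb, ?_, hω⟩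
  rintro _ ⟨n, rfl⟩
  exact (h𝒰 n).1 _ (hb n)

theorem s1_gammaF_of_s1_gammaCl (h : S1 (GammaCl X) (OmegaCl X))
    (hz : StronglyZeroDimensional X) : S1 (GammaF X) (Omega X) := by
  intro 𝒰 h𝒰
  choose 𝒱 h𝒱 hinf F hF hfin using fun n => exists_subfamily_of_mem_gammaF (h𝒰 n)
  have hex (n) (U : Set X) : ∃ C, U ∈ 𝒱 n → IsClopen C ∧ F n U ⊆ C ∧ C ⊆ U := by
    by_cases hU : U ∈ 𝒱 n
    · obtain ⟨C, hC, hFC, hCd⟩ := hz (F n U) Uᶜ (hF n U hU).1 ((h𝒰 n).1 U (h𝒱 n hU))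
        (disjoint_compl_right.mono_left (hF n U hU).2)
      exact ⟨C, fun _ => ⟨hC, hFC, disjoint_compl_right_iff_subset.1 hCd⟩⟩
    · exact ⟨∅, fun h => absurd h hU⟩
  choose C hC using hex
  have hne (n) (U) (hU : U ∈ 𝒱 n) : U ≠ univ := fun he => (h𝒰 n).2.1.1.2 (he ▸ h𝒱 n hU)
  obtain ⟨c, hc, -, hω⟩ := h (fun n => C n '' 𝒱 n) fun n => by
    refine ⟨?_, isGammaCover_image (hinf n) _ (fun U hU he => ?_) fun x => ?_⟩
    · rintro _ ⟨U, hU, rfl⟩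
      exact (hC n U hU).1
    · exact hne n U hU (univ_subset_iff.1 (he ▸ (hC n U hU).2.2))
    · exact (hfin n x).subset fun U hU => ⟨hU.1, fun hx => hU.2 ((hC n U hU.1).2.1 hx)⟩
  choose b hb hbc using hc
  refine ⟨b, fun n => h𝒱 n (hb n), ?_, isOmegaCover_range (fun n => hne n _ (hb n)) fun K => ?_⟩
  · rintro _ ⟨n, rfl⟩
    exact ((h𝒰 n).1 _ (h𝒱 n (hb n))).isOpen
  · obtain ⟨_, ⟨n, rfl⟩, hn⟩ := hω.2 K K.finite_toSet
    exact ⟨n, hn.trans (hbc n ▸ (hC n _ (hb n)).2.2)⟩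

end CoverSelection

/-! ### Velichko's theorem -/

section Velichko

variable {X : Type u}

/-- A closed subset of a metric space is the zero-set of a nonnegative continuous function. -/
theorem exists_nonneg_continuousMap_eq_zero_iff {H : Type*} [MetricSpace H] {R : Set H}
    (hR : IsClosed R) : ∃ ρ : C(H, ℝ), (∀ z, 0 ≤ ρ z) ∧ ∀ z, ρ z = 0 ↔ z ∈ R := by
  rcases R.eq_empty_or_nonempty with rfl | hne
  · exact ⟨1, fun z => by simp, fun z => by simp⟩
  · exact ⟨⟨fun z => Metric.infDist z R, Metric.continuous_infDist_pt R⟩,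
      fun z => Metric.infDist_nonneg, fun z => (hR.mem_iff_infDist_zero hne).symm⟩

/-- Given a countable cover by closed sets of a metric space `H` and a real number for each of
them, the function sending a point to the number of the first set containing it is the eventually
constant limit of continuous functions on `H`. -/
theorem exists_eventually_eq_of_closed_cover {H : Type*} [MetricSpace H] (u : X → H)
    (R : ℕ → Set H) (hR : ∀ j, IsClosed (R j)) (hcov : ∀ x, ∃ j, u x ∈ R j) (c : ℕ → ℝ) :
    ∃ e : ℕ → C(H, ℝ), ∀ x, ∃ j, u x ∈ R j ∧ ∀ᶠ n in atTop, e n (u x) = c j := by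
  classical
  choose ρ hρ0 hρ using fun j => exists_nonneg_continuousMap_eq_zero_iff (hR j)
  -- `ψ n j` is `1` on `R j` and at each point outside is eventually `0`; the products below cancel
  -- every term after the first hit.
  let ψ : ℕ → ℕ → C(H, ℝ) := fun n j => ⟨fun z => max 0 (1 - n * ρ j z), by fun_prop⟩
  refine ⟨fun n => ⟨fun z => ∑ j ∈ Finset.range n,
    c j * ψ n j z * ∏ i ∈ Finset.range j, (1 - ψ n i z), by fun_prop⟩, fun x => ?_⟩
  have hJ := Nat.find_spec (hcov x)
  have hmin : ∀ i < Nat.find (hcov x), u x ∉ R i := fun i hi => Nat.find_min (hcov x) hi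
  generalize Nat.find (hcov x) = J at hJ hmin
  have h1 (n : ℕ) : ψ n J (u x) = 1 := by simp [ψ, (hρ J _).2 hJ]
  have h0 : ∀ i < J, ∀ᶠ n in atTop, ψ n i (u x) = 0 := fun i hi => by
    have hpos : 0 < ρ i (u x) :=
      lt_of_le_of_ne (hρ0 i _) fun h => hmin i hi ((hρ i _).1 h.symm)
    filter_upwards [(tendsto_natCast_atTop_atTop.atTop_mul_const hpos).eventually_ge_atTop 1]
      with n hn
    exact max_eq_left (by linarith)
  have h0' : ∀ᶠ n in atTop, ∀ i ∈ Finset.range J, ψ n i (u x) = 0 :=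
    (Finset.eventually_all _).2 fun i hi => h0 i (Finset.mem_range.1 hi)
  refine ⟨J, hJ, ?_⟩
  filter_upwards [h0', eventually_gt_atTop J] with n hn hJn
  show ∑ j ∈ Finset.range n, c j * ψ n j (u x) * ∏ i ∈ Finset.range j, (1 - ψ n i (u x)) = c J
  rw [Finset.sum_eq_single_of_mem J (Finset.mem_range.2 hJn)]
  · rw [h1, Finset.prod_eq_one fun i hi => by rw [hn i hi, sub_zero]]
    ring
  · intro j _ hj
    rcases lt_or_gt_of_ne hj with hlt | hlt
    · simp [hn j (Finset.mem_range.2 hlt)]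
    · rw [Finset.prod_eq_zero (Finset.mem_range.2 hlt) (by rw [h1, sub_self]), mul_zero]

/-- A uniform limit of eventually constant limits of continuous functions is a pointwise limit of
continuous functions. -/
theorem exists_tendsto_of_uniform_approx {H : Type*} [TopologicalSpace H] (u : X → H)
    (h : X → ℝ) (happ : ∀ ε : ℝ, 0 < ε → ∃ s : X → ℝ, (∀ x, |s x - h x| ≤ ε) ∧
      ∃ e : ℕ → C(H, ℝ), ∀ x, ∀ᶠ n in atTop, e n (u x) = s x) :
    ∃ d : ℕ → C(H, ℝ), ∀ x, Tendsto (fun n => d n (u x)) atTop (𝓝 (h x)) := by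
  have hpow (k : ℕ) : (0 : ℝ) < (1 / 2) ^ k := by positivity
  choose s hs e he using fun k : ℕ => happ ((1 / 2) ^ k) (hpow k)
  let clip : ℝ → ℝ → ℝ := fun r t => max (-r) (min r t)
  have hclip (r) : Continuous (clip r) := by fun_prop
  have hclip_eq {r t : ℝ} (ht : |t| ≤ r) : clip r t = t := by
    rw [abs_le] at ht
    simp [clip, ht.1, ht.2]
  have hclip_le {r : ℝ} (hr : 0 ≤ r) (t : ℝ) : |clip r t| ≤ r := by
    rw [abs_le]
    exact ⟨le_max_left _ _, max_le (by linarith) (min_le_left _ _)⟩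
  have hstep (k x) : |s (k + 1) x - s k x| ≤ 2 * (1 / 2) ^ k := by
    have h1 := abs_le.1 (hs (k + 1) x)
    have h2 := abs_le.1 (hs k x)
    have h3 := hpow k
    rw [pow_succ] at h1
    rw [abs_le]
    constructor <;> linarith [h1.1, h1.2, h2.1, h2.2]
  -- Clipping at the bound for `s (k + 1) - s k` controls the tail uniformly in `n`, without
  -- changing the increments once they are exact.
  let T : ℕ → ℕ → H → ℝ := fun n k z => clip (2 * (1 / 2) ^ k) (e (k + 1) n z - e k n z)
  have hT (n k) : Continuous (T n k) := (hclip _).comp (by fun_prop)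
  refine ⟨fun n => ⟨fun z => e 0 n z + ∑ k ∈ Finset.range n, T n k z, by fun_prop⟩, fun x => ?_⟩
  have htail (m n K : ℕ) (hK : K ≤ m) :
      |∑ k ∈ Finset.range m, T n k (u x) - ∑ k ∈ Finset.range K, T n k (u x)|
        ≤ 4 * (1 / 2) ^ K - 4 * (1 / 2) ^ m := by
    induction m, hK using Nat.le_induction with
    | base => simp
    | succ m hm ih =>
      have h1 : |T n m (u x)| ≤ 2 * (1 / 2) ^ m := hclip_le (by positivity) _
      rw [abs_le] at ih h1 ⊢
      rw [Finset.sum_range_succ, pow_succ]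
      constructor <;> linarith [ih.1, ih.2, h1.1, h1.2]
  rw [Metric.tendsto_atTop']
  intro ε hε
  -- The tail costs at most `4 * (1 / 2) ^ K` and `s K` is off by at most `(1 / 2) ^ K`, together
  -- five.
  obtain ⟨K, hK⟩ := exists_pow_lt_of_lt_one (show 0 < ε / 5 by positivity)
    (show (1 / 2 : ℝ) < 1 by norm_num)
  have hev : ∀ᶠ n in atTop, ∀ k ∈ Finset.range (K + 1), e k n (u x) = s k x :=
    (Finset.eventually_all _).2 fun k _ => he k x
  obtain ⟨N, hN⟩ := eventually_atTop.1 (hev.and (eventually_ge_atTop K))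
  refine ⟨N, fun n hn => ?_⟩
  obtain ⟨heq, hKn⟩ := hN n hn.le
  have hsum : e 0 n (u x) + ∑ k ∈ Finset.range K, T n k (u x) = s K x := by
    rw [Finset.sum_congr rfl (g := fun k => s (k + 1) x - s k x), Finset.sum_range_sub
      (fun k => s k x), heq 0 (by simp)]
    · ring
    · intro k hk
      have hk' := Finset.mem_range.1 hk
      simp only [T]
      rw [heq (k + 1) (by simpa using hk'), heq k (by simp; omega)]
      exact hclip_eq (hstep k x)
  have h1 := abs_le.1 (htail n n K hKn)
  have h2 := abs_le.1 (hs K x)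
  have h3 := hpow n
  rw [Real.dist_eq]
  show |e 0 n (u x) + ∑ k ∈ Finset.range n, T n k (u x) - h x| < ε
  rw [abs_lt]
  constructor <;> linarith [h1.1, h1.2, h2.1, h2.2]

variable [TopologicalSpace X]

/-- The cozero-sets `{|h - q i| < ε}` are countable unions of traces of closed subsets of the
Hilbert cube, so assigning `q i` on the first such trace approximates `h` uniformly. Hence `h` is a
pointwise limit of functions from the cube, where `C(ℕ → unitInterval, ℝ)` is separable in the
uniform metric. -/
theorem VelichkoV.sequentiallySeparable (hV : VelichkoV X) : SequentiallySeparable (Cp X) := by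
  obtain ⟨Y, _, _, f, hf, hbij, hcoz⟩ := hV
  obtain ⟨ι, hι⟩ := Metric.PiNatEmbed.exists_embedding_to_hilbert_cube (X := Y)
  let : MetricSpace (ℕ → unitInterval) := TopologicalSpace.metrizableSpaceMetric _
  let u : X → ℕ → unitInterval := ι ∘ f
  have hu : Continuous u := hι.continuous.comp hf
  have happ (h : Cp X) : ∃ d : ℕ → C(ℕ → unitInterval, ℝ),
      ∀ x, Tendsto (fun n => d n (u x)) atTop (𝓝 (h.1 x)) := by
    refine exists_tendsto_of_uniform_approx u h.1 fun ε hε => ?_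
    obtain ⟨q, hq⟩ := TopologicalSpace.exists_dense_seq ℝ
    choose F hF hFU using fun i : ℕ => hcoz {x | |h.1 x - q i| < ε}
      (isCozeroSet_lt (h.2.sub continuous_const).abs continuous_const)
    choose R hR hRF using fun i k => hι.isInducing.isClosed_iff.1 (hF i k)
    have hmem (i k x) : u x ∈ R i k ↔ f x ∈ F i k := by rw [← hRF]; rfl
    have hval {i k x} (hx : u x ∈ R i k) : |h.1 x - q i| < ε := by
      have h1 : f x ∈ f '' {x | |h.1 x - q i| < ε} :=
        hFU i ▸ mem_iUnion_of_mem k ((hmem i k x).1 hx)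
      exact (hbij.1.mem_set_image).1 h1
    obtain ⟨e, he⟩ := exists_eventually_eq_of_closed_cover u
      (fun j => R j.unpair.1 j.unpair.2) (fun j => hR _ _) (fun x => by
        obtain ⟨i, hi⟩ := hq.exists_dist_lt (h.1 x) hε
        have h1 : f x ∈ ⋃ n, F i n := by
          rw [← hFU]
          exact mem_image_of_mem f hi
        obtain ⟨k, hk⟩ := mem_iUnion.1 h1
        exact ⟨Nat.pair i k, by simpa [hmem] using hk⟩) (fun j => q j.unpair.1)
    choose j hj hje using he
    refine ⟨fun x => q (j x).unpair.1, fun x => ?_, e, hje⟩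
    rw [abs_sub_comm]
    exact (hval (hj x)).le
  obtain ⟨D, hDc, hD⟩ := TopologicalSpace.exists_countable_dense C(ℕ → unitInterval, ℝ)
  refine ⟨(fun d : C(ℕ → unitInterval, ℝ) => (⟨d ∘ u, d.continuous.comp hu⟩ : Cp X)) '' D,
    hDc.image _, eq_univ_of_forall fun h => ?_⟩
  obtain ⟨d, hd⟩ := happ h
  choose d' hd'D hd' using fun n : ℕ =>
    hD.exists_dist_lt (d n) (show (0 : ℝ) < 1 / ((n : ℝ) + 1) by positivity)
  refine ⟨_, fun n => mem_image_of_mem _ (hd'D n), Cp.tendsto_iff.2 fun x => ?_⟩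
  refine tendsto_of_tendsto_of_dist (hd x) (squeeze_zero (fun _ => dist_nonneg) (fun n => ?_)
    (tendsto_one_div_add_atTop_nhds_zero_nat (𝕜 := ℝ)))
  exact (ContinuousMap.dist_apply_le_dist (u x)).trans (hd' n).le

/-- The sequence `d` separates points because its limits do, so it gives an injection into `ℝ^ℕ`. If
`|h|` is the limit of `d (i k)`, then `|h x| > 0` exactly when the coordinates `i k` stay above some
`1 / (r + 1)` from some `k` on, a countable union of closed conditions. -/
theorem SequentiallySeparable.velichkoV [T35Space X] (hs : SequentiallySeparable (Cp X)) :
    VelichkoV X := by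
  have : Nonempty (Cp X) := ⟨⟨0, continuous_zero⟩⟩
  obtain ⟨d, hd, -⟩ := hs.exists_seq
  let : MetricSpace (ℕ → ℝ) := TopologicalSpace.metrizableSpaceMetric _
  let p : X → ULift.{u} (ℕ → ℝ) := fun x => ⟨fun n => (d n).1 x⟩
  have hp : Continuous p := continuous_uliftUp.comp (continuous_pi fun n => (d n).2)
  have hinj : Function.Injective p := by
    intro x y hxy
    by_contra hne
    obtain ⟨h, hh, h0, h1⟩ := CompletelyRegularSpace.completely_regular x {y} isClosed_singleton
      (by simpa using hne)
    obtain ⟨a, ha, hah⟩ := mem_seqDenseSets hd ⟨fun z => (h z : ℝ), by fun_prop⟩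
    have hax (n) : (a n).1 x = (a n).1 y := by
      obtain ⟨i, hi⟩ := ha n
      rw [← hi]
      exact congrFun (congrArg ULift.down hxy) i
    have h2 := tendsto_nhds_unique (Cp.tendsto_iff.1 hah x)
      ((Cp.tendsto_iff.1 hah y).congr fun n => (hax n).symm)
    have h3 : h y = 1 := h1 rfl
    simp [h0, h3] at h2
  have : SecondCountableTopology (ULift.{u} (ℕ → ℝ)) := Homeomorph.ulift.secondCountableTopology
  refine ⟨range p, inferInstance, inferInstance, rangeFactorization p, hp.rangeFactorization,
    ⟨fun x y hxy => hinj (congrArg Subtype.val hxy), rangeFactorization_surjective⟩, ?_⟩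
  rintro U ⟨h, hh, hU⟩
  obtain ⟨a, ha, hah⟩ := mem_seqDenseSets hd ⟨fun x => |h x|, hh.abs⟩
  choose i hi using ha
  refine ⟨fun m => {y | ∀ k ≥ m.unpair.1, 1 / ((m.unpair.2 : ℝ) + 1) ≤ y.1.down (i k)},
    fun m => ?_, ?_⟩
  · simp only [ofPred_forall]
    refine isClosed_iInter fun k => isClosed_iInter fun _ => isClosed_le continuous_const ?_
    exact (continuous_apply (i k)).comp (continuous_uliftDown.comp continuous_subtype_val)
  · have hmem (x) : x ∈ U ↔ ∃ m : ℕ, ∀ k ≥ m.unpair.1,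
        1 / ((m.unpair.2 : ℝ) + 1) ≤ (a k).1 x := by
      have hx : x ∈ U ↔ 0 < |h x| := by
        rw [← compl_compl U, hU]
        simp
      have hlim : Tendsto (fun k => (a k).1 x) atTop (𝓝 |h x|) := Cp.tendsto_iff.1 hah x
      rw [hx]
      constructor
      · intro hpos
        obtain ⟨r, hr⟩ := exists_nat_one_div_lt hpos
        obtain ⟨N, hN⟩ := eventually_atTop.1 (hlim.eventually_const_le hr)
        exact ⟨Nat.pair N r, by simpa using hN⟩
      · rintro ⟨m, hm⟩
        have h1 : 1 / ((m.unpair.2 : ℝ) + 1) ≤ |h x| :=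
          ge_of_tendsto hlim (eventually_atTop.2 ⟨_, hm⟩)
        exact lt_of_lt_of_le (by positivity) h1
    ext ⟨_, x, rfl⟩
    have himg : (⟨p x, mem_range_self x⟩ : range p) ∈ rangeFactorization p '' U ↔ x ∈ U := by
      constructor
      · rintro ⟨y, hy, he⟩
        exact hinj (congrArg Subtype.val he) ▸ hy
      · intro hx
        exact ⟨x, hx, rfl⟩
    rw [himg, hmem]
    simp only [← hi, mem_iUnion]
    rfl

theorem velichkoV_iff_sequentiallySeparable [T35Space X] :
    VelichkoV X ↔ SequentiallySeparable (Cp X) :=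
  ⟨VelichkoV.sequentiallySeparable, SequentiallySeparable.velichkoV⟩

end Velichko

theorem s1_gammaF_omega_iff_nullSelection {X : Type u} [TopologicalSpace X] :
    S1 (GammaF X) (Omega X) ↔ NullSelection X :=
  ⟨NullSelection.of_s1_gammaF, NullSelection.s1_gammaF_omega⟩

end SelectionPrinciples

theorem mainTheorem3 {X : Type*} [TopologicalSpace X] [T35Space X] [Nonempty X] :
    List.TFAE [
      SelectionPrinciples.S1 (SelectionPrinciples.seqDenseSets (SelectionPrinciples.Cp X))
          (SelectionPrinciples.denseSets (SelectionPrinciples.Cp X)) ∧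
        SelectionPrinciples.SequentiallySeparable (SelectionPrinciples.Cp X),
      SelectionPrinciples.S1 (SelectionPrinciples.GammaF X) (SelectionPrinciples.Omega X) ∧
        SelectionPrinciples.VelichkoV X,
      SelectionPrinciples.S1 (SelectionPrinciples.GammaCl X) (SelectionPrinciples.OmegaCl X) ∧
        SelectionPrinciples.VelichkoV X ∧
        SelectionPrinciples.StronglyZeroDimensional X,
      (∀ f : SelectionPrinciples.Cp X,
          SelectionPrinciples.S1 (SelectionPrinciples.GammaAt f) (SelectionPrinciples.OmegaAt f)) ∧
        SelectionPrinciples.SequentiallySeparable (SelectionPrinciples.Cp X),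
      (∀ f : SelectionPrinciples.Cp X,
          SelectionPrinciples.S1 (SelectionPrinciples.seqDenseSets (SelectionPrinciples.Cp X))
            (SelectionPrinciples.OmegaAt f)) ∧
        SelectionPrinciples.SequentiallySeparable (SelectionPrinciples.Cp X)] := by
  -- The second condition becomes `NullSelection` with sequential separability and serves as the hub
  -- for all the others.
  rw [SelectionPrinciples.velichkoV_iff_sequentiallySeparable, SelectionPrinciples.s1_gammaF_omega_iff_nullSelection]
  tfae_have 2 → 1 := fun h => ⟨h.1.s1_seqDense_dense h.2, h.2⟩
  tfae_have 1 → 2 := fun h => ⟨.of_seqDenseSets h.2 fun A hA => by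
    obtain ⟨b, hb, hd⟩ := h.1 A hA
    exact ⟨b, hb, hd _⟩, h.2⟩
  tfae_have 2 → 3 := fun h =>
    ⟨SelectionPrinciples.s1_gammaCl_of_s1_gammaF h.1.s1_gammaF_omega, h.2, h.1.stronglyZeroDimensional⟩
  tfae_have 3 → 2 := fun h => ⟨.of_s1_gammaF (SelectionPrinciples.s1_gammaF_of_s1_gammaCl h.1 h.2.2), h.2.1⟩
  tfae_have 2 → 4 := fun h => ⟨h.1.s1_gammaAt_omegaAt, h.2⟩
  tfae_have 4 → 2 := fun h => ⟨.of_s1_gammaAt (h.1 _), h.2⟩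
  tfae_have 2 → 5 := fun h => ⟨h.1.s1_seqDense_omegaAt, h.2⟩
  tfae_have 5 → 2 := fun h => ⟨.of_seqDenseSets h.2 fun A hA => by
    obtain ⟨b, hb, hd⟩ := h.1 _ A hA
    exact ⟨b, hb, hd.1⟩, h.2⟩
  tfae_finish
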